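/- Let $\mathbb F_q$ be a finite field with $q$ elements, let $\mathcal M=\{1,\dots,m\}$ be a set of users with $m\le q$, and let user $i$ observe $\mathbf A_i\mathbf w$, where $\mathbf w\in\mathbb F_q^N$ is the file and $\mathbf A_i\in\mathbb F_q^{\ell_i\times N}$ is a given matrix. For $\mathcal S\subseteq\mathcal M$ let $\mathbf A_{\mathcal S}$ be the matrix obtained by stacking the $\mathbf A_i$, $i\in\mathcal S$. For $\beta\in\mathbb Z_{\ge 0}$ call an integer vector $\mathbf R=(R_1,\dots,R_m)$ feasible if $\sum_i R_i=\beta$ and $\sum_{i\in\mathcal S}R_i\ge N-\operatorname{rank}(\mathbf A_{\mathcal M\setminus\mathcal S})$ for every $\mathcal S\subsetneq\mathcal M$. Let $\varphi_1,\dots,\varphi_m$ be non-decreasing convex cost functions on the non-negative integers, and call a feasible $\mathbf R$ optimal if it minimizes $\sum_i\varphi_i(R_i)$ among the feasible vectors. Fix $\beta$ such that a feasible vector exists. Consider schemes with $\beta$ rounds, where in round $j$ one user $i$ is scheduled and transmits $\mathbf u^{(j)}\cdot\mathbf w$ with $\mathbf u^{(j)}=\mathbf b_i^{(j)}\mathbf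 A_i$, and where the vectors $\mathbf b_i^{(j)}$ are independent and uniformly distributed on $\mathbb F_q^{\ell_i}$. The sequence $\mathbf u^{(1)},\dots,\mathbf u^{(\beta)}$ is called optimal if every user can recover the file, i.e. $\operatorname{rank}(\mathbf A_i\cup\mathbf u^{(1)}\cup\dots\cup\mathbf u^{(\beta)})=N$ for all $i\in\mathcal M$, and the vector $\mathbf R$ whose entry $R_i$ is the number of transmissions of user $i$ is optimal. 1. (Randomized algorithm.) Suppose that in round $j$ the scheduled user minimizes $\varphi_i(R_i+1)-\varphi_i(R_i)$, where $R_i$ is the number of earlier transmissions of user $i$, over the set $$\mathcal T_j=\{\,i\in\mathcal M:\ \operatorname{rank}(\mathbf A_i\cup\mathbf u^{(1)}\cup\dots\cup\mathbf u^{(j-1)})>N-(\beta-j+1)\,\},$$ ties being broken by any rule that depends only on the previous rounds (and with an arbitrary choice if $\mathcal T_j=\emptyset$). Then the sequence $\mathbf u^{(1)},\dots,\mathbf u^{(\beta)}$ is optimal with probability at least $\left(1-\frac mq\right)^{\beta}$. 2. (Given optimal rates.) The same bound holds if the scheduled users are fixed in advance in such a way that the resulting vector $\mathbf R$ is optimal.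 -/

import Mathlib

namespace DataExchange

open Finset Module

section Model

variable {F : Type*} [Field F] {m N : ℕ} {ℓ : Fin m → ℕ}

/-- `rank(A_S)`: the rank of the stack of the observation matrices of the users in `S`. -/
noncomputable def jointRank (A : ∀ i : Fin m, Matrix (Fin (ℓ i)) (Fin N) F)
    (S : Finset (Fin m)) : ℕ :=
  finrank F (Submodule.span F (⋃ i ∈ S, Set.range (A i).row))

/-- The integer rate vectors of sum-rate `β` in the cut-set region:
`R(M) = β` and `R(S) ≥ N - rank(A_{M ∖ S})` for every proper subset `S` of `M`. -/
def IsFeasibleRate (A : ∀ i : Fin m, Matrix (Fin (ℓ i)) (Fin N) F) (β : ℕ)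
    (R : Fin m → ℕ) : Prop :=
  ∑ i, R i = β ∧
    ∀ S : Finset (Fin m), S ≠ univ → (N : ℤ) - jointRank A Sᶜ ≤ ∑ i ∈ S, (R i : ℤ)

/-- `R` minimizes the separable cost among the feasible rate vectors of sum-rate `β`. -/
def IsOptimalRate (A : ∀ i : Fin m, Matrix (Fin (ℓ i)) (Fin N) F) (φ : Fin m → ℕ → ℝ) (β : ℕ)
    (R : Fin m → ℕ) : Prop :=
  IsFeasibleRate A β R ∧ ∀ R', IsFeasibleRate A β R' → ∑ i, φ i (R i) ≤ ∑ i, φ i (R' i)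

/-- A record of transmissions in the order in which they were made:
the transmitting user together with the transmitted vector `u` of coefficients. -/
abbrev History (F : Type*) (m N : ℕ) := List (Fin m × (Fin N → F))

/-- The number of transmissions of each user. -/
def rates (h : History F m N) : Fin m → ℕ := fun i => (h.map Prod.fst).count i

/-- `rank(A_i ∪ u⁽¹⁾ ∪ ⋯)`: what user `i` knows after the transmissions in `h`. -/
noncomputable def knowledgeRank (A : ∀ i : Fin m, Matrix (Fin (ℓ i)) (Fin N) F)
    (h : History F m N) (i : Fin m) : ℕ :=
  finrank F (Submodule.span F (Set.range (A i).row ∪ {u | u ∈ h.map Prod.snd}))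

/-- The transmissions are optimal: every user can recover the file, and the rate vector is a
cost minimizer for the sum-rate `β`. -/
def IsOptimalTransmission (A : ∀ i : Fin m, Matrix (Fin (ℓ i)) (Fin N) F)
    (φ : Fin m → ℕ → ℝ) (β : ℕ) (h : History F m N) : Prop :=
  (∀ i, knowledgeRank A h i = N) ∧ IsOptimalRate A φ β (rates h)

/-- The set `T_j` of the users that may transmit in round `j`, where `j - 1 = h.length`:
`rank(A_i ∪ u⁽¹⁾ ∪ ⋯ ∪ u⁽ʲ⁻¹⁾) > N - (β - j + 1)`. -/
def eligible (A : ∀ i : Fin m, Matrix (Fin (ℓ i)) (Fin N) F) (β : ℕ) (h : History F m N) :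
    Set (Fin m) :=
  {i | (N : ℤ) - ((β : ℤ) - h.length) < knowledgeRank A h i}

/-- The discrete derivative `d_i(R_i + 1)` at the current rates. -/
def marginalCost (φ : Fin m → ℕ → ℝ) (h : History F m N) (i : Fin m) : ℝ :=
  φ i (rates h i + 1) - φ i (rates h i)

/-- `sel` is a rule that selects in each round an eligible user of least marginal cost; ties are
broken in an arbitrary, possibly history-dependent, way. Nothing is asked where no user is
eligible. -/
def IsGreedyRule (A : ∀ i : Fin m, Matrix (Fin (ℓ i)) (Fin N) F) (φ : Fin m → ℕ → ℝ) (β : ℕ)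
    (sel : History F m N → Fin m) : Prop :=
  ∀ h : History F m N, h.length < β → (eligible A β h).Nonempty →
    sel h ∈ eligible A β h ∧ ∀ k ∈ eligible A β h, marginalCost φ h (sel h) ≤ marginalCost φ h k

/-- The run of the scheme in which `sel` chooses the transmitting user and, when user `i` is
chosen in round `j`, the vector `b_i⁽ʲ⁾ A_i` is transmitted. -/
def run (A : ∀ i : Fin m, Matrix (Fin (ℓ i)) (Fin N) F) (sel : History F m N → Fin m) {β : ℕ}
    (b : Fin β → ∀ i : Fin m, Fin (ℓ i) → F) : History F m N :=
  (List.ofFn b).foldl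
    (fun h c => h ++ [(sel h, Matrix.vecMul (c (sel h)) (A (sel h)))]) []

/-- The transmissions with a schedule `s` that is fixed in advance. -/
def scheduled (A : ∀ i : Fin m, Matrix (Fin (ℓ i)) (Fin N) F) {β : ℕ} (s : Fin β → Fin m)
    (b : Fin β → ∀ i : Fin m, Fin (ℓ i) → F) : History F m N :=
  List.ofFn fun j => (s j, Matrix.vecMul (b j (s j)) (A (s j)))

end Model

/-- The probability of `E` under the uniform distribution on a finite type. -/
noncomputable def uniformProb {Ω : Type*} [Fintype Ω] [Nonempty Ω] (E : Set Ω) : ℝ :=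
  ((PMF.uniformOfFintype Ω).toOuterMeasure E).toReal

end DataExchange

/-!
Fix the transmissions `h` made so far and let `d C` be the dimension of what the users in `C` know
jointly. A rate vector for the `r` remaining rounds satisfies the cut-set conditions relative to
this knowledge iff `R(C) ≤ r - N + d C` for every nonempty `C`, with equality for all users
together (`IsCompletion`). Since `d` is submodular, tight sets that meet are closed under union and
intersection, and both halves of the argument rest on this.

*Randomness.* Let user `i` with `R i ≥ 1` transmit a random vector of its row space. The vector
`R - e_i` is a completion afterwards unless the transmitted vector lies in the joint knowledge of a
tight set that avoids `i`. For each `j` there is a largest tight set that contains `j` and avoids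
`i`; hence at most `m` subspaces have to be avoided, and none of them contains the row space of
`i`, because otherwise the constraint of the tight set with `i` added would fail. Each is hit with
probability at most `1 / q`, so a round fails with probability at most `m / q`
(`IsCompletion.exists_forbidden`, `IsCompletion.le_card_good`). The rounds multiply up
(`pow_mul_card_le_card_of_prefix`), and a completion with no rounds left says that everybody knows
the file. For a schedule fixed in advance this is the whole proof.

*Greedy choice.* The invariant is that some completion extends the rates used so far to an optimal
rate vector. If the selected user `i` has no transmission in that completion, its eligibility makes
it possible to exchange a transmission of some `j` for one of `i`
(`IsCompletion.exists_exchange`). The user `j` is eligible as well, so by convexity and the minimal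
marginal cost of `i` the exchange does not raise the cost (`sum_cost_exchange_le`). The new vector
is still feasible for the original problem because a transmission raises the knowledge of a set by
at most one dimension, and not at all if the transmitter belongs to the set
(`IsCompletion.isFeasibleRate_add`).
-/

namespace DataExchange

open Finset Module

/-! ### Integer vectors in an intersecting polymatroid -/

section Completion

variable {ι : Type*} [DecidableEq ι]

theorem sum_add_single (Q : ι → ℕ) (i : ι) (C : Finset ι) :
    ∑ k ∈ C, (Q + Pi.single i 1 : ι → ℕ) k = ∑ k ∈ C, Q k + if i ∈ C then 1 else 0 := by
  simp [sum_add_distrib, Pi.single_apply]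

theorem sub_single_add_single {R : ι → ℕ} {i : ι} (h : 1 ≤ R i) :
    R - Pi.single i 1 + Pi.single i 1 = R := by
  ext k
  by_cases hk : k = i
  · subst hk
    simp
    omega
  · simp [hk]

variable [Fintype ι]

/-- `R` distributes `r` transmissions over the users so that `R(C) ≤ r - N + d C` for every
nonempty set `C` of users. When `d C` is the dimension of what the users in `C` know jointly, this
is the cut-set condition `R(Cᶜ) ≥ N - d C`, written with upper bounds. -/
def IsCompletion (d : Finset ι → ℕ) (N r : ℕ) (R : ι → ℕ) : Prop :=
  ∑ i, R i = r ∧ ∀ C : Finset ι, C.Nonempty → ∑ i ∈ C, R i + N ≤ r + d C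

/-- A nonempty set whose constraint in `IsCompletion` holds with equality. -/
def IsTight (d : Finset ι → ℕ) (N r : ℕ) (R : ι → ℕ) (C : Finset ι) : Prop :=
  C.Nonempty ∧ ∑ i ∈ C, R i + N = r + d C

variable {d : Finset ι → ℕ} {N r : ℕ} {R : ι → ℕ}

theorem IsCompletion.isTight_union_inter
    (hsub : ∀ C D, d (C ∪ D) + d (C ∩ D) ≤ d C + d D)
    (hR : IsCompletion d N r R) {C D : Finset ι} (hC : IsTight d N r R C)
    (hD : IsTight d N r R D) (hCD : (C ∩ D).Nonempty) :
    IsTight d N r R (C ∪ D) ∧ IsTight d N r R (C ∩ D) := by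
  have hne : (C ∪ D).Nonempty := hC.1.mono subset_union_left
  have h1 := hR.2 _ hne
  have h2 := hR.2 _ hCD
  have h3 := hsub C D
  have h4 := sum_union_inter (s₁ := C) (s₂ := D) (f := R)
  have h5 := hC.2
  have h6 := hD.2
  exact ⟨⟨hne, by omega⟩, ⟨hCD, by omega⟩⟩

/-- A user `i` whose own constraint leaves room for a transmission can take one over from some
user `j`. The user `j` is found in the smallest tight set that contains `i`; that set carries a
positive rate because its bound is at least the bound of `{i}`. -/
theorem IsCompletion.exists_exchange (hmono : Monotone d)
    (hsub : ∀ C D, d (C ∪ D) + d (C ∩ D) ≤ d C + d D) (huniv : d univ ≤ N)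
    (hR : IsCompletion d N r R) {i : ι} (hi : N < r + d {i}) :
    ∃ (Q : ι → ℕ) (j : ι), R = Q + Pi.single j 1 ∧ IsCompletion d N r (Q + Pi.single i 1) := by
  have hfull : IsTight d N r R univ := by
    have hne : (univ : Finset ι).Nonempty := ⟨i, mem_univ i⟩
    have := hR.2 _ hne
    have := hR.1
    exact ⟨hne, by omega⟩
  obtain ⟨D, -, hD⟩ := (Set.toFinite {C | IsTight d N r R C ∧ i ∈ C}).exists_le_minimal
    (show univ ∈ {C | IsTight d N r R C ∧ i ∈ C} from ⟨hfull, mem_univ i⟩)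
  obtain ⟨⟨hDt, hiD⟩, hDmin⟩ := hD
  have hDle : ∀ C, IsTight d N r R C → i ∈ C → D ⊆ C := fun C hC hiC =>
    (hDmin ⟨(hR.isTight_union_inter hsub hC hDt ⟨i, mem_inter.2 ⟨hiC, hiD⟩⟩).2,
      mem_inter.2 ⟨hiC, hiD⟩⟩ inter_subset_right).trans inter_subset_left
  obtain ⟨j, hjD, hj⟩ : ∃ j ∈ D, 1 ≤ R j := by
    by_contra! hcon
    have h0 : ∑ k ∈ D, R k = 0 := sum_eq_zero fun k hk => by have := hcon k hk; omega
    have h1 : d {i} ≤ d D := hmono (singleton_subset_iff.2 hiD)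
    have h2 := hDt.2
    omega
  refine ⟨R - Pi.single j 1, j, (sub_single_add_single hj).symm, ?_, fun C hC => ?_⟩
  all_goals
    have key : ∀ C : Finset ι, ∑ k ∈ C, R k
        = ∑ k ∈ C, (R - Pi.single j 1 : ι → ℕ) k + if j ∈ C then 1 else 0 := fun C => by
      rw [← sum_add_single, sub_single_add_single hj]
  · have h1 := key univ
    have h2 := hR.1
    rw [sum_add_single]
    simp only [mem_univ, if_true] at h1 ⊢
    omega
  · have h1 := key C
    have h2 := hR.2 C hC
    rw [sum_add_single]
    by_cases hjC : j ∈ C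
    · rw [if_pos hjC] at h1
      split_ifs <;> omega
    · by_cases hiC : i ∈ C
      · have h3 : ∑ k ∈ C, R k + N ≠ r + d C := fun h => hjC (hDle C ⟨hC, h⟩ hiC hjD)
        rw [if_neg hjC] at h1
        rw [if_pos hiC]
        omega
      · rw [if_neg hjC] at h1
        rw [if_neg hiC]
        omega

/-- Exchanging a transmission of `j` for one of `i` does not raise a convex separable cost if `i`
has the smaller marginal cost at `x` and no transmission beyond `x`. -/
theorem sum_cost_exchange_le {φ : ι → ℕ → ℝ}
    (hconv : ∀ i n, φ i (n + 1) - φ i n ≤ φ i (n + 2) - φ i (n + 1))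
    (x Q : ι → ℕ) {i j : ι} (hQ : Q i = 0)
    (hij : φ i (x i + 1) - φ i (x i) ≤ φ j (x j + 1) - φ j (x j)) :
    ∑ k, φ k ((x + (Q + Pi.single i 1) : ι → ℕ) k) ≤
      ∑ k, φ k ((x + (Q + Pi.single j 1) : ι → ℕ) k) := by
  have hincr : ∀ n, φ j (x j + 1) - φ j (x j) ≤ φ j (x j + n + 1) - φ j (x j + n) := by
    intro n
    induction n with
    | zero => simp
    | succ n ih => exact ih.trans (hconv j (x j + n))
  have hsum : ∀ a : ι, ∑ k, φ k ((x + (Q + Pi.single a 1) : ι → ℕ) k)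
      = ∑ k, φ k (x k + Q k) + (φ a (x a + Q a + 1) - φ a (x a + Q a)) := by
    intro a
    rw [← sub_eq_iff_eq_add', ← sum_sub_distrib, sum_eq_single a]
    · simp [add_assoc]
    · intro b _ hb
      simp [hb]
    · simp
  have h1 := hincr (Q j)
  rw [hsum, hsum, hQ]
  simp only [add_zero]
  linarith

end Completion

/-! ### The space known to a set of users -/

section Knowledge

theorem rates_append {F : Type*} {m N : ℕ} (h : History F m N) (i : Fin m) (u : Fin N → F) :
    rates (h ++ [(i, u)]) = rates h + Pi.single i 1 := by
  ext k
  simp [rates, Pi.single_apply, List.count_singleton, eq_comm (a := i)]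

variable {F : Type*} [Field F] {m N : ℕ} {ℓ : Fin m → ℕ}

/-- The coefficient vectors of the linear combinations of the file that the users in `C` can
compute jointly after the transmissions in `h`. -/
def knowledge (A : ∀ i : Fin m, Matrix (Fin (ℓ i)) (Fin N) F) (h : History F m N)
    (C : Finset (Fin m)) : Submodule F (Fin N → F) :=
  Submodule.span F ((⋃ i ∈ C, Set.range (A i).row) ∪ {u | u ∈ h.map Prod.snd})

/-- The dimension of `knowledge`, as a set function. -/
noncomputable def jointKnowledgeRank (A : ∀ i : Fin m, Matrix (Fin (ℓ i)) (Fin N) F)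
    (h : History F m N) (C : Finset (Fin m)) : ℕ :=
  finrank F (knowledge A h C)

variable (A : ∀ i : Fin m, Matrix (Fin (ℓ i)) (Fin N) F) (h : History F m N)

theorem jointKnowledgeRank_singleton (i : Fin m) :
    jointKnowledgeRank A h {i} = knowledgeRank A h i := by
  rw [jointKnowledgeRank, knowledge, knowledgeRank, Finset.set_biUnion_singleton]

theorem jointKnowledgeRank_nil (C : Finset (Fin m)) :
    jointKnowledgeRank A [] C = jointRank A C := by
  have h0 : {u | u ∈ ([] : History F m N).map Prod.snd} = (∅ : Set (Fin N → F)) := by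
    ext u
    simp
  rw [jointKnowledgeRank, knowledge, jointRank, h0, Set.union_empty]

theorem knowledge_mono : Monotone (knowledge A h) := fun _ _ hCD =>
  Submodule.span_mono (Set.union_subset_union_left _ (Set.biUnion_subset_biUnion_left hCD))

theorem knowledge_union (C D : Finset (Fin m)) :
    knowledge A h (C ∪ D) = knowledge A h C ⊔ knowledge A h D := by
  rw [knowledge, knowledge, knowledge, ← Submodule.span_union, ← Set.union_union_distrib_right]
  congr 2
  ext u
  simp [or_and_right, exists_or]

theorem knowledge_append (i : Fin m) (u : Fin N → F) (C : Finset (Fin m)) :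
    knowledge A (h ++ [(i, u)]) C = knowledge A h C ⊔ Submodule.span F {u} := by
  rw [knowledge, knowledge, ← Submodule.span_union, Set.union_assoc]
  congr 2
  ext v
  simp [or_comm]

theorem row_mem_knowledge {i : Fin m} {C : Finset (Fin m)} (hi : i ∈ C) (a : Fin (ℓ i)) :
    (A i).row a ∈ knowledge A h C :=
  Submodule.subset_span (Or.inl (Set.mem_biUnion hi ⟨a, rfl⟩))

theorem vecMul_mem_knowledge {i : Fin m} {C : Finset (Fin m)} (hi : i ∈ C)
    (c : Fin (ℓ i) → F) : Matrix.vecMul c (A i) ∈ knowledge A h C := by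
  rw [Matrix.vecMul_eq_sum]
  exact Submodule.sum_mem _ fun a _ => Submodule.smul_mem _ _ (row_mem_knowledge A h hi a)

theorem knowledge_insert_of_row_mem {i : Fin m} {C : Finset (Fin m)}
    (hi : ∀ a, (A i).row a ∈ knowledge A h C) :
    knowledge A h (insert i C) = knowledge A h C := by
  refine le_antisymm (Submodule.span_le.2 ?_) (knowledge_mono A h (subset_insert i C))
  rintro u (hu | hu)
  · simp only [Set.mem_iUnion, mem_insert] at hu
    obtain ⟨k, rfl | hk, a, rfl⟩ := hu
    · exact hi a
    · exact row_mem_knowledge A h hk a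
  · exact Submodule.subset_span (Or.inr hu)

theorem jointKnowledgeRank_mono : Monotone (jointKnowledgeRank A h) := fun _ _ hCD =>
  Submodule.finrank_mono (knowledge_mono A h hCD)

theorem jointKnowledgeRank_le (C : Finset (Fin m)) : jointKnowledgeRank A h C ≤ N := by
  simpa [jointKnowledgeRank] using Submodule.finrank_le (knowledge A h C)

theorem jointKnowledgeRank_submodular (C D : Finset (Fin m)) :
    jointKnowledgeRank A h (C ∪ D) + jointKnowledgeRank A h (C ∩ D)
      ≤ jointKnowledgeRank A h C + jointKnowledgeRank A h D := by
  have h1 := Submodule.finrank_sup_add_finrank_inf_eq (knowledge A h C) (knowledge A h D)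
  have h2 : finrank F (knowledge A h (C ∩ D)) ≤
      finrank F (knowledge A h C ⊓ knowledge A h D : Submodule F (Fin N → F)) :=
    Submodule.finrank_mono (le_inf (knowledge_mono A h inter_subset_left)
      (knowledge_mono A h inter_subset_right))
  rw [← knowledge_union] at h1
  simp only [jointKnowledgeRank]
  omega

theorem jointKnowledgeRank_append_le (i : Fin m) (u : Fin N → F) (C : Finset (Fin m)) :
    jointKnowledgeRank A (h ++ [(i, u)]) C ≤ jointKnowledgeRank A h C + 1 := by
  rw [jointKnowledgeRank, knowledge_append]
  exact (Submodule.finrank_add_le_finrank_add_finrank _ _).trans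
    (Nat.add_le_add_left ((finrank_span_le_card _).trans (by simp)) _)

theorem jointKnowledgeRank_le_append (i : Fin m) (u : Fin N → F) (C : Finset (Fin m)) :
    jointKnowledgeRank A h C ≤ jointKnowledgeRank A (h ++ [(i, u)]) C := by
  rw [jointKnowledgeRank, jointKnowledgeRank, knowledge_append]
  exact Submodule.finrank_mono le_sup_left

theorem jointKnowledgeRank_lt_append (i : Fin m) {u : Fin N → F} {C : Finset (Fin m)}
    (hu : u ∉ knowledge A h C) :
    jointKnowledgeRank A h C < jointKnowledgeRank A (h ++ [(i, u)]) C := by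
  rw [jointKnowledgeRank, jointKnowledgeRank, knowledge_append]
  refine Submodule.finrank_lt_finrank_of_lt (lt_of_le_of_ne le_sup_left fun heq => hu ?_)
  rw [heq]
  exact Submodule.mem_sup_right (Submodule.mem_span_singleton_self u)

theorem isFeasibleRate_iff_isCompletion (β : ℕ) (R : Fin m → ℕ) :
    IsFeasibleRate A β R ↔ IsCompletion (jointKnowledgeRank A []) N β R := by
  refine and_congr_right fun hsum => ?_
  have key : ∀ C : Finset (Fin m),
      ((N : ℤ) - jointRank A C ≤ ∑ i ∈ Cᶜ, (R i : ℤ) ↔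
        ∑ i ∈ C, R i + N ≤ β + jointKnowledgeRank A [] C) := by
    intro C
    have h1 := sum_add_sum_compl C R
    rw [jointKnowledgeRank_nil, ← Nat.cast_sum]
    omega
  constructor
  · intro hS C hC
    refine (key C).1 ?_
    have := hS Cᶜ (by rwa [Ne, compl_eq_univ_iff, ← Ne, ← nonempty_iff_ne_empty])
    rwa [compl_compl] at this
  · intro hC S hS
    have := (key Sᶜ).2 (hC Sᶜ (by rwa [nonempty_iff_ne_empty, Ne, compl_eq_empty_iff]))
    rwa [compl_compl] at this

variable {A h}

/-- When no transmissions remain, every user knows the file. -/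
theorem IsCompletion.knowledgeRank_eq {R : Fin m → ℕ}
    (hR : IsCompletion (jointKnowledgeRank A h) N 0 R) (i : Fin m) :
    knowledgeRank A h i = N := by
  have h1 := hR.2 {i} (singleton_nonempty i)
  have h2 := jointKnowledgeRank_le A h {i}
  rw [jointKnowledgeRank_singleton] at h1 h2
  omega

/-- A completion after a transmission of `i` yields a completion before it. -/
theorem IsCompletion.of_append {r : ℕ} {Q : Fin m → ℕ} {i : Fin m} {c : Fin (ℓ i) → F}
    (hQ : IsCompletion (jointKnowledgeRank A (h ++ [(i, Matrix.vecMul c (A i))])) N r Q) :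
    IsCompletion (jointKnowledgeRank A h) N (r + 1) (Q + Pi.single i 1) := by
  refine ⟨?_, fun C hC => ?_⟩
  · rw [sum_add_single, hQ.1, if_pos (mem_univ i)]
  · have h1 := hQ.2 C hC
    rw [sum_add_single]
    by_cases hi : i ∈ C
    · -- The users in `C` learn nothing from a transmission of one of them.
      have h2 : jointKnowledgeRank A (h ++ [(i, Matrix.vecMul c (A i))]) C
          = jointKnowledgeRank A h C := by
        rw [jointKnowledgeRank, jointKnowledgeRank, knowledge_append, sup_eq_left.2]
        exact (Submodule.span_singleton_le_iff_mem _ _).2 (vecMul_mem_knowledge A h hi c)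
      rw [if_pos hi]
      omega
    · have h2 := jointKnowledgeRank_append_le A h i (Matrix.vecMul c (A i)) C
      rw [if_neg hi]
      omega

/-- The rates already used together with a completion form a feasible rate vector. -/
theorem IsCompletion.isFeasibleRate_add :
    ∀ {h : History F m N} {r : ℕ} {R : Fin m → ℕ},
      (∀ p ∈ h, ∃ c, p.2 = Matrix.vecMul c (A p.1)) →
      IsCompletion (jointKnowledgeRank A h) N r R →
      IsFeasibleRate A (h.length + r) (rates h + R) := by
  intro h
  induction h using List.reverseRecOn with
  | nil =>
    intro r R _ hR
    have h0 : rates ([] : History F m N) = 0 := by ext; simp [rates]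
    rw [isFeasibleRate_iff_isCompletion, h0]
    simpa using hR
  | append_singleton h p ih =>
    obtain ⟨i, u⟩ := p
    intro r R hh hR
    obtain ⟨c, rfl⟩ : ∃ c, u = Matrix.vecMul c (A i) := hh (i, u) (by simp)
    have := ih (fun p hp => hh p (List.mem_append_left _ hp)) hR.of_append
    rw [rates_append]
    convert this using 1
    · simp; omega
    · abel

/-- A transmission of a user with a positive remaining rate leaves a completion unless it falls
into the knowledge of one of the sets `D j`: here `D j` is the largest tight set that contains `j`
but not `i`, so every tight set that avoids `i` lies in some `D j`. Only one subspace per user has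
to be avoided, although there may be exponentially many tight sets. -/
theorem IsCompletion.exists_forbidden {r : ℕ} {Q : Fin m → ℕ} {i : Fin m}
    (hQ : IsCompletion (jointKnowledgeRank A h) N (r + 1) (Q + Pi.single i 1)) :
    ∃ (J : Finset (Fin m)) (D : Fin m → Finset (Fin m)),
      (∀ j ∈ J, ∃ a, (A i).row a ∉ knowledge A h (D j)) ∧
      ∀ u, (∀ j ∈ J, u ∉ knowledge A h (D j)) →
        IsCompletion (jointKnowledgeRank A (h ++ [(i, u)])) N r Q := by
  classical
  set T : Fin m → Set (Finset (Fin m)) := fun j =>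
    {C | IsTight (jointKnowledgeRank A h) N (r + 1) (Q + Pi.single i 1) C ∧ j ∈ C ∧ i ∉ C}
  have hmax : ∀ j, ∃ D : Finset (Fin m), (T j).Nonempty → D ∈ T j ∧ ∀ C ∈ T j, C ⊆ D := by
    intro j
    by_cases hne : (T j).Nonempty
    · obtain ⟨D, hD⟩ := (Set.toFinite (T j)).exists_maximal hne
      obtain ⟨⟨hDt, hjD, hiD⟩, hDmax⟩ := hD
      refine ⟨D, fun _ => ⟨⟨hDt, hjD, hiD⟩, fun C ⟨hCt, hjC, hiC⟩ => ?_⟩⟩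
      have := (hQ.isTight_union_inter (jointKnowledgeRank_submodular A h) hCt hDt
        ⟨j, mem_inter.2 ⟨hjC, hjD⟩⟩).1
      exact subset_union_left.trans (hDmax ⟨this, mem_union_left _ hjC, by simp [hiC, hiD]⟩
        subset_union_right)
    · exact ⟨∅, fun h => absurd h hne⟩
  choose D hD using hmax
  refine ⟨univ.filter fun j => (T j).Nonempty, D, fun j hj => ?_, fun u hu => ⟨?_, ?_⟩⟩
  · obtain ⟨⟨⟨hne, ht⟩, hjD, hiD⟩, -⟩ := hD j (mem_filter.1 hj).2
    by_contra! hrow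
    -- Otherwise the constraint of `insert i (D j)` would be violated.
    have h1 := hQ.2 (insert i (D j)) (insert_nonempty _ _)
    have h2 : jointKnowledgeRank A h (insert i (D j)) = jointKnowledgeRank A h (D j) := by
      rw [jointKnowledgeRank, knowledge_insert_of_row_mem A h hrow, jointKnowledgeRank]
    rw [sum_insert hiD, h2] at h1
    have h3 : 1 ≤ (Q + Pi.single i 1 : Fin m → ℕ) i := by simp
    omega
  · have := hQ.1
    rw [sum_add_single, if_pos (mem_univ i)] at this
    omega
  · intro C hC
    have h1 := hQ.2 C hC
    have h2 := jointKnowledgeRank_le_append A h i u C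
    have h3 := sum_add_single Q i C
    by_cases hi : i ∈ C
    · rw [if_pos hi] at h3
      omega
    · rw [if_neg hi] at h3
      by_cases ht : IsTight (jointKnowledgeRank A h) N (r + 1) (Q + Pi.single i 1) C
      · obtain ⟨j, hj⟩ := hC
        have hCT : C ∈ T j := ⟨ht, hj, hi⟩
        have hu' : u ∉ knowledge A h C := fun hmem =>
          hu j (mem_filter.2 ⟨mem_univ j, ⟨C, hCT⟩⟩)
            (knowledge_mono A h ((hD j ⟨C, hCT⟩).2 C hCT) hmem)
        have := jointKnowledgeRank_lt_append A h i hu'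
        omega
      · have : ∑ k ∈ C, (Q + Pi.single i 1 : Fin m → ℕ) k + N ≠ r + 1 + jointKnowledgeRank A h C :=
          fun heq => ht ⟨hC, heq⟩
        omega

end Knowledge

/-! ### Counting good transmissions -/

section Counting

theorem card_submodule_mul_card_le {F V : Type*} [Field F] [Fintype F] [AddCommGroup V]
    [Module F V] [Finite V] {W : Submodule F V} (hW : W ≠ ⊤) :
    Nat.card W * Fintype.card F ≤ Nat.card V := by
  have := Fintype.ofFinite V
  have hlt : finrank F W < finrank F V := Submodule.finrank_lt hW
  rw [Module.natCard_eq_pow_finrank (K := F) (V := W),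
    Module.natCard_eq_pow_finrank (K := F) (V := V),
    Nat.card_eq_fintype_card, ← pow_succ]
  exact Nat.pow_le_pow_right Fintype.card_pos hlt

variable {F : Type*} [Field F] [Fintype F] {m N : ℕ} {ℓ : Fin m → ℕ}
  {A : ∀ i : Fin m, Matrix (Fin (ℓ i)) (Fin N) F} {h : History F m N}

/-- A uniformly random transmission of a user with a positive remaining rate leaves a completion
with probability at least `1 - m / q`. -/
theorem IsCompletion.le_card_good {r : ℕ} {Q : Fin m → ℕ} {i : Fin m}
    (hQ : IsCompletion (jointKnowledgeRank A h) N (r + 1) (Q + Pi.single i 1)) :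
    (1 - (m : ℝ) / Fintype.card F) * Nat.card (∀ i : Fin m, Fin (ℓ i) → F) ≤
      Nat.card {c : ∀ i : Fin m, Fin (ℓ i) → F //
        IsCompletion (jointKnowledgeRank A (h ++ [(i, Matrix.vecMul (c i) (A i))])) N r Q} := by
  classical
  obtain ⟨J, D, hrow, hgood⟩ := hQ.exists_forbidden
  let X := ∀ i : Fin m, Fin (ℓ i) → F
  let L : X →ₗ[F] (Fin N → F) := (A i).vecMulLinear.comp (LinearMap.proj i)
  let W : Fin m → Submodule F X := fun j => (knowledge A h (D j)).comap L
  have hW : ∀ j ∈ J, (#{c : X | c ∈ W j} : ℝ) ≤ Nat.card X / Fintype.card F := by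
    intro j hj
    obtain ⟨a, ha⟩ := hrow j hj
    have hne : W j ≠ ⊤ := by
      intro htop
      have : (Pi.single i (Pi.single a 1) : X) ∈ W j := htop ▸ Submodule.mem_top
      exact ha (by simpa [W, L] using this)
    have h1 := card_submodule_mul_card_le hne
    have h2 : Nat.card (W j) = #{c : X | c ∈ W j} := by
      rw [Nat.card_eq_fintype_card, Fintype.card_subtype]
    rw [le_div_iff₀ (by exact_mod_cast Fintype.card_pos), ← h2]
    exact_mod_cast h1
  have hcover : (univ : Finset X) ⊆ ({c : X | IsCompletion
      (jointKnowledgeRank A (h ++ [(i, Matrix.vecMul (c i) (A i))])) N r Q} : Finset X) ∪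
        J.biUnion fun j => {c : X | c ∈ W j} := by
    intro c _
    by_cases hc : ∃ j ∈ J, c ∈ W j
    · obtain ⟨j, hj, hcj⟩ := hc
      exact mem_union_right _ (mem_biUnion.2 ⟨j, hj, by simpa using hcj⟩)
    · push Not at hc
      exact mem_union_left _ (mem_filter.2 ⟨mem_univ c, hgood (L c) hc⟩)
  have hbad : (#(J.biUnion fun j => ({c : X | c ∈ W j} : Finset X)) : ℝ) ≤
      m * (Nat.card X / Fintype.card F) := by
    calc (#(J.biUnion fun j => ({c : X | c ∈ W j} : Finset X)) : ℝ)
        ≤ ∑ j ∈ J, (#{c : X | c ∈ W j} : ℝ) := by exact_mod_cast card_biUnion_le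
      _ ≤ #J * (Nat.card X / Fintype.card F) := by
          simpa using sum_le_sum hW
      _ ≤ m * (Nat.card X / Fintype.card F) := by
          gcongr
          simpa using card_le_univ J
  have h1 : (Nat.card X : ℝ) ≤ #({c : X | IsCompletion
      (jointKnowledgeRank A (h ++ [(i, Matrix.vecMul (c i) (A i))])) N r Q} : Finset X) +
        #(J.biUnion fun j => ({c : X | c ∈ W j} : Finset X)) := by
    rw [Nat.card_eq_fintype_card, ← card_univ]
    exact_mod_cast (card_le_card hcover).trans (card_union_le _ _)
  rw [Nat.card_eq_fintype_card (α := {c : X // _}), Fintype.card_subtype]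
  have h2 : (1 - (m : ℝ) / Fintype.card F) * Nat.card X =
      Nat.card X - m * (Nat.card X / Fintype.card F) := by ring
  change (1 - (m : ℝ) / Fintype.card F) * Nat.card X ≤ _
  linarith

/-- If a property of the sequence of the samples drawn so far survives each further draw with
probability at least `p`, then it holds after `n` draws with probability at least `p ^ n`. -/
theorem pow_mul_card_le_card_of_prefix {X : Type*} [Finite X] {p : ℝ} (hp : 0 ≤ p)
    {P : List X → Prop} (h0 : P []) (n : ℕ)
    (hstep : ∀ l : List X, l.length < n → P l →
      p * Nat.card X ≤ Nat.card {c : X // P (l ++ [c])}) :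
    p ^ n * Nat.card (Fin n → X) ≤ Nat.card {b : Fin n → X // P (List.ofFn b)} := by
  classical
  have := Fintype.ofFinite X
  induction n with
  | zero =>
    have : Nonempty {b : Fin 0 → X // P (List.ofFn b)} := ⟨⟨Fin.elim0, by simpa using h0⟩⟩
    have : 1 ≤ Nat.card {b : Fin 0 → X // P (List.ofFn b)} := Nat.card_pos
    simpa using this
  | succ n ih =>
    have ih := ih fun l hl => hstep l (hl.trans n.lt_succ_self)
    -- The first `n` draws satisfy `P` and the last one preserves it.
    let f : (Σ b : {b : Fin n → X // P (List.ofFn b)}, {c : X // P (List.ofFn b.1 ++ [c])}) →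
        {b : Fin (n + 1) → X // P (List.ofFn b)} := fun x =>
      ⟨Fin.snoc x.1.1 x.2.1, by
        have := x.2.2
        rw [List.ofFn_succ']
        simpa [List.concat_eq_append] using this⟩
    have hf : Function.Injective f := by
      rintro ⟨⟨b, hb⟩, c, hc⟩ ⟨⟨b', hb'⟩, c', hc'⟩ heq
      have h1 : (Fin.snoc b c : Fin (n + 1) → X) = Fin.snoc b' c' := congrArg Subtype.val heq
      obtain ⟨rfl, rfl⟩ := Fin.snoc_inj.1 h1
      rfl
    have h1 := Nat.card_le_card_of_injective f hf
    rw [Nat.card_sigma] at h1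
    calc p ^ (n + 1) * Nat.card (Fin (n + 1) → X)
        = (p ^ n * Nat.card (Fin n → X)) * (p * Nat.card X) := by
          simp only [Nat.card_fun, Nat.card_fin]
          push_cast
          ring
      _ ≤ Nat.card {b : Fin n → X // P (List.ofFn b)} * (p * Nat.card X) := by gcongr
      _ = ∑ b : {b : Fin n → X // P (List.ofFn b)}, p * Nat.card X := by
          simp [Nat.card_eq_fintype_card]
      _ ≤ ∑ b : {b : Fin n → X // P (List.ofFn b)},
            (Nat.card {c : X // P (List.ofFn b.1 ++ [c])} : ℝ) :=
          sum_le_sum fun b _ => hstep _ (by simp) b.2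
      _ ≤ Nat.card {b : Fin (n + 1) → X // P (List.ofFn b)} := by exact_mod_cast h1

theorem uniformProb_eq {Ω : Type*} [Fintype Ω] [Nonempty Ω] (E : Set Ω) :
    uniformProb E = Nat.card E / Nat.card Ω := by
  classical
  rw [uniformProb, PMF.toOuterMeasure_uniformOfFintype_apply, Nat.card_eq_fintype_card,
    Nat.card_eq_fintype_card]
  simp

/-- The probability form of `pow_mul_card_le_card_of_prefix`. -/
theorem pow_le_uniformProb_of_prefix {X : Type*} [Fintype X] [Nonempty X] {p : ℝ} (hp : 0 ≤ p)
    {P : List X → Prop} (h0 : P []) {n : ℕ}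
    (hstep : ∀ l : List X, l.length < n → P l →
      p * Nat.card X ≤ Nat.card {c : X // P (l ++ [c])})
    {E : Set (Fin n → X)} (hE : ∀ b, P (List.ofFn b) → b ∈ E) :
    p ^ n ≤ uniformProb E := by
  rw [uniformProb_eq, le_div_iff₀ (by exact_mod_cast Nat.card_pos)]
  refine (pow_mul_card_le_card_of_prefix hp h0 n hstep).trans ?_
  exact_mod_cast Nat.card_mono (Set.toFinite E) hE

end Counting

/-! ### The greedy rule and fixed schedules -/

section Schemes

variable {F : Type*} [Field F] {m N : ℕ} {ℓ : Fin m → ℕ}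

theorem exists_isOptimalRate (A : ∀ i : Fin m, Matrix (Fin (ℓ i)) (Fin N) F)
    (φ : Fin m → ℕ → ℝ) {β : ℕ} (hβ : ∃ R, IsFeasibleRate A β R) :
    ∃ R, IsOptimalRate A φ β R := by
  have hfin : {R | IsFeasibleRate A β R}.Finite :=
    (Set.finite_Iic fun _ : Fin m => β).subset fun R hR i =>
      (single_le_sum (f := R) (fun _ _ => Nat.zero_le _) (mem_univ i)).trans hR.1.le
  obtain ⟨R, hR, hmin⟩ := Set.exists_min_image _ (fun R => ∑ i, φ i (R i)) hfin hβ
  exact ⟨R, hR, hmin⟩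

/-- The user chosen by the greedy rule transmits next in some cost-optimal completion: if the
given completion has no transmission of that user, one is exchanged, and convexity shows that the
exchange does not raise the cost. -/
theorem IsGreedyRule.exists_optimal_completion
    {A : ∀ i : Fin m, Matrix (Fin (ℓ i)) (Fin N) F} {φ : Fin m → ℕ → ℝ}
    (hconv : ∀ i n, φ i (n + 1) - φ i n ≤ φ i (n + 2) - φ i (n + 1)) {β : ℕ}
    {sel : History F m N → Fin m} (hsel : IsGreedyRule A φ β sel) {h : History F m N} {r : ℕ}
    (hr : h.length + (r + 1) = β) (hh : ∀ p ∈ h, ∃ c, p.2 = Matrix.vecMul c (A p.1))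
    {R : Fin m → ℕ} (hR : IsCompletion (jointKnowledgeRank A h) N (r + 1) R)
    (hopt : IsOptimalRate A φ β (rates h + R)) :
    ∃ Q : Fin m → ℕ,
      IsCompletion (jointKnowledgeRank A h) N (r + 1) (Q + Pi.single (sel h) 1) ∧
      IsOptimalRate A φ β (rates h + (Q + Pi.single (sel h) 1)) := by
  have helig : ∀ k, k ∈ eligible A β h ↔ N < r + 1 + jointKnowledgeRank A h {k} := by
    intro k
    rw [eligible, Set.mem_ofPred_eq, jointKnowledgeRank_singleton]
    omega
  have hpos : ∀ k, 1 ≤ R k → k ∈ eligible A β h := by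
    intro k hk
    have := hR.2 {k} (singleton_nonempty k)
    rw [sum_singleton] at this
    exact (helig k).2 (by omega)
  obtain ⟨k, hk⟩ : ∃ k, 1 ≤ R k := by
    by_contra! hcon
    have h0 : ∑ k, R k = 0 := sum_eq_zero fun k _ => by have := hcon k; omega
    have := hR.1
    omega
  obtain ⟨hi, hmin⟩ := hsel h (by omega) ⟨k, hpos k hk⟩
  by_cases hRi : 1 ≤ R (sel h)
  · refine ⟨R - Pi.single (sel h) 1, ?_⟩
    rw [sub_single_add_single hRi]
    exact ⟨hR, hopt⟩
  obtain ⟨Q, j, rfl, hQ⟩ := hR.exists_exchange (jointKnowledgeRank_mono A h)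
    (jointKnowledgeRank_submodular A h) (jointKnowledgeRank_le A h univ) ((helig _).1 hi)
  have hQi : Q (sel h) = 0 := by
    rw [Pi.add_apply] at hRi
    omega
  have hj := hmin j (hpos j (by simp))
  refine ⟨Q, hQ, hr ▸ hQ.isFeasibleRate_add hh, fun R' hR' => ?_⟩
  exact (sum_cost_exchange_le hconv (rates h) Q hQi hj).trans (hopt.2 R' hR')

variable [Fintype F]

theorem one_sub_div_card_nonneg (hq : m ≤ Fintype.card F) :
    0 ≤ 1 - (m : ℝ) / Fintype.card F := by
  rw [sub_nonneg, div_le_one (by exact_mod_cast Fintype.card_pos)]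
  exact_mod_cast hq

theorem le_uniformProb_run (A : ∀ i : Fin m, Matrix (Fin (ℓ i)) (Fin N) F)
    (hq : m ≤ Fintype.card F) {φ : Fin m → ℕ → ℝ}
    (hconv : ∀ i n, φ i (n + 1) - φ i n ≤ φ i (n + 2) - φ i (n + 1)) {β : ℕ}
    (hβ : ∃ R, IsFeasibleRate A β R) {sel : History F m N → Fin m}
    (hsel : IsGreedyRule A φ β sel) :
    (1 - (m : ℝ) / Fintype.card F) ^ β ≤
      uniformProb {b : Fin β → ∀ i : Fin m, Fin (ℓ i) → F |
        IsOptimalTransmission A φ β (run A sel b)} := by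
  let hist : List (∀ i : Fin m, Fin (ℓ i) → F) → History F m N := fun l =>
    l.foldl (fun h c => h ++ [(sel h, Matrix.vecMul (c (sel h)) (A (sel h)))]) []
  have hist_append : ∀ l c, hist (l ++ [c]) =
      hist l ++ [(sel (hist l), Matrix.vecMul (c (sel (hist l))) (A (sel (hist l))))] := by
    intro l c
    simp [hist]
  have hist_length : ∀ l, (hist l).length = l.length := by
    intro l
    induction l using List.reverseRecOn with
    | nil => rfl
    | append_singleton l c ih => simp [hist_append, ih]
  have hist_mem : ∀ l, ∀ p ∈ hist l, ∃ c, p.2 = Matrix.vecMul c (A p.1) := by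
    intro l
    induction l using List.reverseRecOn with
    | nil => simp [hist]
    | append_singleton l c ih =>
      intro p hp
      rw [hist_append, List.mem_append, List.mem_singleton] at hp
      rcases hp with hp | rfl
      · exact ih p hp
      · exact ⟨_, rfl⟩
  -- The invariant: some completion extends the rates used so far to an optimal rate vector.
  refine pow_le_uniformProb_of_prefix (one_sub_div_card_nonneg hq)
    (P := fun l => ∃ R, IsCompletion (jointKnowledgeRank A (hist l)) N (β - l.length) R ∧
      IsOptimalRate A φ β (rates (hist l) + R)) ?_ ?_ ?_
  · obtain ⟨R, hR⟩ := exists_isOptimalRate A φ hβ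
    have h0 : rates (hist []) = 0 := by ext; simp [rates, hist]
    exact ⟨R, (isFeasibleRate_iff_isCompletion A β R).1 hR.1, by rwa [h0, zero_add]⟩
  · rintro l hl ⟨R, hR, hopt⟩
    obtain ⟨r, hr⟩ : ∃ r, l.length + (r + 1) = β := ⟨β - l.length - 1, by omega⟩
    have hr' : β - l.length = r + 1 := by omega
    rw [hr'] at hR
    obtain ⟨Q, hQ, hQopt⟩ := hsel.exists_optimal_completion hconv
      (by rw [hist_length]; exact hr) (hist_mem l) hR hopt
    refine hQ.le_card_good.trans ?_
    have hr'' : β - (l.length + 1) = r := by omega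
    refine Nat.cast_le.2 (Nat.card_mono (Set.toFinite _) fun c hc => ⟨Q, ?_, ?_⟩)
    · rw [hist_append, List.length_append, List.length_singleton, hr'']
      exact hc
    · rw [hist_append, rates_append, add_assoc, add_comm (Pi.single _ _)]
      exact hQopt
  · rintro b ⟨R, hR, hopt⟩
    rw [List.length_ofFn, Nat.sub_self] at hR
    have hR0 : R = 0 := by
      ext k
      exact (sum_eq_zero_iff.1 hR.1) k (mem_univ k)
    rw [hR0, add_zero] at hopt
    exact ⟨hR.knowledgeRank_eq, hopt⟩

theorem le_uniformProb_scheduled (A : ∀ i : Fin m, Matrix (Fin (ℓ i)) (Fin N) F)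
    (hq : m ≤ Fintype.card F) {φ : Fin m → ℕ → ℝ} {β : ℕ} {s : Fin β → Fin m}
    (hs : IsOptimalRate A φ β (fun i => (List.ofFn s).count i)) :
    (1 - (m : ℝ) / Fintype.card F) ^ β ≤
      uniformProb {b : Fin β → ∀ i : Fin m, Fin (ℓ i) → F |
        IsOptimalTransmission A φ β (scheduled A s b)} := by
  let f : Fin m → (∀ i : Fin m, Fin (ℓ i) → F) → Fin m × (Fin N → F) := fun i c =>
    (i, Matrix.vecMul (c i) (A i))
  -- The invariant: the transmissions still scheduled form a completion.
  refine pow_le_uniformProb_of_prefix (one_sub_div_card_nonneg hq)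
    (P := fun l => IsCompletion (jointKnowledgeRank A (List.zipWith f (List.ofFn s) l)) N
      (β - l.length) fun i => ((List.ofFn s).drop l.length).count i) ?_ ?_ ?_
  · simpa using (isFeasibleRate_iff_isCompletion A β _).1 hs.1
  · intro l hl hP
    have hl' : l.length < (List.ofFn s).length := by simpa using hl
    have hdrop := List.drop_eq_getElem_cons hl'
    set i := (List.ofFn s)[l.length]
    have hzip : ∀ c, List.zipWith f (List.ofFn s) (l ++ [c]) =
        List.zipWith f (List.ofFn s) l ++ [(i, Matrix.vecMul (c i) (A i))] := by
      intro c
      have hlen : ((List.ofFn s).take l.length).length = l.length := by simp; omega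
      have hsplit := List.take_append_drop l.length (List.ofFn s)
      rw [hdrop] at hsplit
      rw [← hsplit, List.zipWith_append hlen]
      have hnil := List.zipWith_append (f := f) hlen (l₁' := i :: (List.ofFn s).drop (l.length + 1))
        (l₂' := [])
      rw [List.append_nil] at hnil
      simp [hnil, f]
    obtain ⟨r, hr⟩ : ∃ r, β - l.length = r + 1 := ⟨β - l.length - 1, by omega⟩
    have hr' : β - (l.length + 1) = r := by omega
    have hcount : (fun k => ((List.ofFn s).drop l.length).count k) =
        (fun k => ((List.ofFn s).drop (l.length + 1)).count k) + Pi.single i 1 := by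
      ext k
      rw [hdrop]
      simp [List.count_cons, Pi.single_apply, eq_comm (a := i)]
    rw [hr, hcount] at hP
    refine hP.le_card_good.trans (le_of_eq ?_)
    simp only [hzip, List.length_append, List.length_singleton, hr']
  · intro b hP
    have hzip : List.zipWith f (List.ofFn s) (List.ofFn b) = scheduled A s b := by
      refine List.ext_getElem (by simp [scheduled]) fun k h1 h2 => ?_
      rw [List.getElem_zipWith, List.getElem_ofFn, List.getElem_ofFn]
      simp [scheduled, f]
    have hrates : rates (scheduled A s b) = fun i => (List.ofFn s).count i := by
      ext i
      rw [rates, scheduled, List.map_ofFn]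
      rfl
    rw [hzip, List.length_ofFn, Nat.sub_self] at hP
    exact ⟨hP.knowledgeRank_eq, hrates ▸ hs⟩

end Schemes

end DataExchange

theorem mainTheorem6 {F : Type*} [Field F] [Fintype F] {m N : ℕ} {ℓ : Fin m → ℕ}
    (A : ∀ i : Fin m, Matrix (Fin (ℓ i)) (Fin N) F)
    (hq : m ≤ Fintype.card F)
    (φ : Fin m → ℕ → ℝ)
    (hmono : ∀ i, Monotone (φ i))
    (hconv : ∀ i n, φ i (n + 1) - φ i n ≤ φ i (n + 2) - φ i (n + 1))
    (β : ℕ) (hβ : ∃ R, DataExchange.IsFeasibleRate A β R) :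
    (∀ sel : DataExchange.History F m N → Fin m, DataExchange.IsGreedyRule A φ β sel →
      (1 - (m : ℝ) / Fintype.card F) ^ β ≤
        DataExchange.uniformProb {b : Fin β → ∀ i : Fin m, Fin (ℓ i) → F |
          DataExchange.IsOptimalTransmission A φ β (DataExchange.run A sel b)}) ∧
    (∀ s : Fin β → Fin m,
      DataExchange.IsOptimalRate A φ β (fun i => (List.ofFn s).count i) →
      (1 - (m : ℝ) / Fintype.card F) ^ β ≤
        DataExchange.uniformProb {b : Fin β → ∀ i : Fin m, Fin (ℓ i) → F |
          DataExchange.IsOptimalTransmission A φ β (DataExchange.scheduled A s b)}) := by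
  exact ⟨fun _ hsel => DataExchange.le_uniformProb_run A hq hconv hβ hsel,
    fun _ hs => DataExchange.le_uniformProb_scheduled A hq hs⟩
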